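/- Let $\{0,1\}^*$ be the set of finite binary strings. A prefix machine with side information is a partial computable map $T(p\mid y)$ from pairs of strings (program $p$, side information $y$) to strings such that, for every $y$, no halting program is a proper prefix of another halting program; put $K_T(s\mid y)=\min\{\ell(p): T(p\mid y)=s\}$. Let $U$ be an (additively) optimal universal prefix machine, i.e. a prefix machine such that for every prefix machine $T$ there is a constant $c_T$ with $K_U(s\mid y)\le K_T(s\mid y)+c_T$ for all $s,y$, and write $K=K_U$. For $u\in[0,1]^n$ let $K(u\mid n,m)$ be the length of a shortest program that, given (a standard encoding of) $n$ and $m$, prints a binary representation of $u$ (the concatenation of finite binary expansions of $u_1,\dots,u_n$, all of the same length) and halts; it is $\infty$ if there is none. For $x\in[0,1]^n$ and an integer $m\ge 1$ define the Kolmogorov complexity of $x$ at resolution $m$ and the Kolmogorov information dimension of $x$ at resolution $m$ by $$K^{[\cdot]_m}(x)=\inf_{u\in[0,1]^n}\{K(u\mid n,m):\ \|x-u\|_\infty\le 2^{-m}\},\qquad \kappa_{m,n}(x)=\frac{K^{[\cdot]_m}(x)}{m}.$$ **Theorem 1.** Let $n,d,m\ge 1$, let $x_o\in[0,1]^n$,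 let $\kappa_{m,n}=\kappa_{m,n}(x_o)$, and let $A$ be a random $d\times n$ matrix with i.i.d. $\mathcal N(0,1)$ entries. Let $\hat x_o$ denote a solution of minimum complexity pursuit for $y_o=Ax_o$, that is, a minimiser of $K^{[\cdot]_m}(x)$ over all $x\in[0,1]^n$ with $Ax=y_o$ (if there are several minimisers, any choice of $\hat x_o$ as a function of the randomness is allowed; if the choice is not measurable, $\mathbb P$ below is the outer probability). Then for every $t\in(0,1)$, $$\mathbb P\left(\|x_o-\hat x_o\|_2>\left(\frac{1}{\sqrt{1-t}}\left(\sqrt{\frac nd}+2\right)+1\right)\frac{\sqrt n}{2^m}\right)\le 2^{\kappa_{m,n}m}\,e^{\frac d2(t+\log(1-t))}+e^{-d/2},$$ where $\log$ is the natural logarithm. -/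

import Mathlib

open MeasureTheory ProbabilityTheory
open scoped Matrix

/-- A prefix machine with side information: a partial computable map sending a binary program `p`
and a binary side-information string `y` to a binary output string, such that for every `y` no
halting program is a proper prefix of another halting program. -/
structure IsPrefixMachine (T : List Bool → List Bool →. List Bool) : Prop where
  partrec : Partrec₂ T
  prefixFree : ∀ y p q : List Bool, (T p y).Dom → (T q y).Dom → p <+: q → p = q

/-- `K_T(s | y)`: the length of a shortest program that makes `T` print `s` and halt, given the
side information `y` (`⊤` if there is none). -/
noncomputable def condKolmogorov (T : List Bool → List Bool →. List Bool) (s y : List Bool) : ℕ∞ :=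
  ⨅ (p : List Bool) (_ : s ∈ T p y), (p.length : ℕ∞)

/-- An (additively) optimal universal prefix machine. -/
structure IsOptimalPrefixMachine (U : List Bool → List Bool →. List Bool) : Prop
    extends IsPrefixMachine U where
  optimal : ∀ T : List Bool → List Bool →. List Bool, IsPrefixMachine T →
    ∃ c : ℕ, ∀ s y : List Bool, condKolmogorov U s y ≤ condKolmogorov T s y + c

/-- The binary string presenting the pair `(n, m)`: the usual self-delimiting pairing
`1^{ℓ(a)} 0 a b`, where `a` and `b` are the binary representations of `n` and `m`. -/
def pairString (n m : ℕ) : List Bool :=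
  List.replicate (Computability.encodeNat n).length true ++ [false] ++
    Computability.encodeNat n ++ Computability.encodeNat m

/-- `s` is a binary representation of the vector `u`: for some precision `ℓ`, every coordinate of
`u` has the finite binary expansion `u i = ∑_{j < ℓ} b i j * 2^{-(j+1)}`, and `s` is the
concatenation of the `n` blocks `b i` of length `ℓ`. -/
def IsBinaryRep {n : ℕ} (s : List Bool) (u : Fin n → ℝ) : Prop :=
  ∃ (ℓ : ℕ) (b : Fin n → Fin ℓ → Bool),
    s = (List.ofFn fun i => List.ofFn (b i)).flatten ∧
    ∀ i, u i = ∑ j : Fin ℓ, (if b i j then (1 : ℝ) else 0) * (1 / 2) ^ ((j : ℕ) + 1)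

/-- `K(u | n, m)` for a real vector `u`: the length of a shortest program that prints a binary
representation of `u` and halts, given `n` and `m` (`⊤` if there is none). -/
noncomputable def vecKolmogorov (U : List Bool → List Bool →. List Bool) {n : ℕ} (m : ℕ)
    (u : Fin n → ℝ) : ℕ∞ :=
  ⨅ (s : List Bool) (_ : IsBinaryRep s u), condKolmogorov U s (pairString n m)

/-- The Kolmogorov complexity of `x` at resolution `m`. The norm on `Fin n → ℝ` is the sup norm. -/
noncomputable def resKolmogorov (U : List Bool → List Bool →. List Bool) {n : ℕ} (m : ℕ)
    (x : Fin n → ℝ) : ℕ∞ :=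
  ⨅ (u : Fin n → ℝ) (_ : u ∈ Set.Icc (0 : Fin n → ℝ) 1 ∧ ‖x - u‖ ≤ (1 / 2) ^ m),
    vecKolmogorov U m u

/-- The Kolmogorov information dimension of `x` at resolution `m`. The complexity is finite when
`U` is optimal and `x` lies in the unit cube, see `resKolmogorov_ne_top`. -/
noncomputable def infoDim (U : List Bool → List Bool →. List Bool) {n : ℕ} (m : ℕ)
    (x : Fin n → ℝ) : ℝ :=
  ((resKolmogorov U m x).toNat : ℝ) / m

/-- `x` is a solution of minimum complexity pursuit for the measurements `y`: it minimises the
complexity at resolution `m` over the points of the unit cube that are consistent with `y`. -/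
def IsMCPSolution (U : List Bool → List Bool →. List Bool) {d n : ℕ} (m : ℕ)
    (A : Matrix (Fin d) (Fin n) ℝ) (y : Fin d → ℝ) (x : Fin n → ℝ) : Prop :=
  (x ∈ Set.Icc (0 : Fin n → ℝ) 1 ∧ A *ᵥ x = y) ∧
  ∀ z ∈ Set.Icc (0 : Fin n → ℝ) 1, A *ᵥ z = y → resKolmogorov U m x ≤ resKolmogorov U m z

theorem condKolmogorov_ne_top {U : List Bool → List Bool →. List Bool}
    (hU : IsOptimalPrefixMachine U) (s y : List Bool) : condKolmogorov U s y ≠ ⊤ := by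
  let T : List Bool → List Bool →. List Bool :=
    fun p _ => ((if p = [] then some s else none : Option (List Bool)) : Part (List Bool))
  have hT : IsPrefixMachine T := by
    refine ⟨?_, ?_⟩
    · have hp : PrimrecPred fun a : List Bool × List Bool => a.1 = [] :=
        Primrec.eq.comp Primrec.fst (Primrec.const [])
      have h : Computable fun a : List Bool × List Bool =>
          (if a.1 = [] then some s else none : Option (List Bool)) :=
        (Primrec.ite hp (Primrec.const (some s)) (Primrec.const none)).to_comp
      exact Computable.ofOption h
    · intro y p q hp hq _
      have key : ∀ p : List Bool, (T p y).Dom → p = [] := by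
        intro p hp
        by_contra h
        simp [T, h] at hp
      rw [key p hp, key q hq]
  obtain ⟨c, hc⟩ := hU.optimal T hT
  have h0 : condKolmogorov T s y ≤ 0 := by
    refine (iInf₂_le ([] : List Bool) ?_).trans (by simp)
    simp [T]
  have h1 : condKolmogorov U s y ≤ (c : ℕ∞) := by
    refine (hc s y).trans ?_
    calc condKolmogorov T s y + c ≤ 0 + c := by gcongr
      _ = c := by simp
  exact ne_top_of_le_ne_top (ENat.natCast_ne_top c) h1

/-- Truncated binary expansions approximate the points of the unit interval. -/
theorem exists_bits (m : ℕ) : ∀ x : ℝ, 0 ≤ x → x ≤ 1 → ∃ b : Fin m → Bool,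
    0 ≤ x - ∑ j : Fin m, (if b j then (1 : ℝ) else 0) * (1 / 2) ^ ((j : ℕ) + 1) ∧
    x - ∑ j : Fin m, (if b j then (1 : ℝ) else 0) * (1 / 2) ^ ((j : ℕ) + 1) ≤ (1 / 2) ^ m := by
  induction m with
  | zero => intro x h0 h1; exact ⟨fun _ => false, by simpa using h0, by simpa using h1⟩
  | succ m ih =>
    intro x h0 h1
    have step : ∀ (e : Bool) (z : ℝ), 0 ≤ z → z ≤ 1 → x = ((if e then 1 else 0) + z) / 2 →
        ∃ b : Fin (m + 1) → Bool,
        0 ≤ x - ∑ j : Fin (m + 1), (if b j then (1 : ℝ) else 0) * (1 / 2) ^ ((j : ℕ) + 1) ∧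
        x - ∑ j : Fin (m + 1), (if b j then (1 : ℝ) else 0) * (1 / 2) ^ ((j : ℕ) + 1)
          ≤ (1 / 2) ^ (m + 1) := by
      intro e z hz0 hz1 hx
      obtain ⟨b, hb0, hb1⟩ := ih z hz0 hz1
      refine ⟨Fin.cons e b, ?_⟩
      have hs : ∑ j : Fin (m + 1), (if (Fin.cons e b : Fin (m + 1) → Bool) j then (1 : ℝ) else 0)
            * (1 / 2) ^ ((j : ℕ) + 1)
          = ((if e then 1 else 0) +
            ∑ j : Fin m, (if b j then (1 : ℝ) else 0) * (1 / 2) ^ ((j : ℕ) + 1)) / 2 := by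
        rw [Fin.sum_univ_succ, add_div, Finset.sum_div]
        congr 1
        · cases e <;> simp
        · refine Finset.sum_congr rfl fun j _ => ?_
          simp only [Fin.cons_succ, Fin.val_succ]
          rw [pow_succ _ ((j : ℕ) + 1)]
          ring
      rw [hs, hx, pow_succ]
      constructor <;> linarith
    by_cases h : x ≤ 1 / 2
    · exact step false (2 * x) (by linarith) (by linarith) (by simp)
    · exact step true (2 * x - 1) (by linarith) (by linarith) (by simp)

theorem resKolmogorov_ne_top {U : List Bool → List Bool →. List Bool}
    (hU : IsOptimalPrefixMachine U) {n : ℕ} (m : ℕ) {x : Fin n → ℝ}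
    (hx : x ∈ Set.Icc (0 : Fin n → ℝ) 1) : resKolmogorov U m x ≠ ⊤ := by
  choose b hb0 hb1 using fun i => exists_bits m (x i) (hx.1 i) (hx.2 i)
  let u : Fin n → ℝ :=
    fun i => ∑ j : Fin m, (if b i j then (1 : ℝ) else 0) * (1 / 2) ^ ((j : ℕ) + 1)
  have hu : u ∈ Set.Icc (0 : Fin n → ℝ) 1 ∧ ‖x - u‖ ≤ (1 / 2) ^ m := by
    refine ⟨⟨fun i => ?_, fun i => ?_⟩, ?_⟩
    · exact Finset.sum_nonneg fun j _ => by positivity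
    · exact (sub_nonneg.1 (hb0 i)).trans (hx.2 i)
    · refine (pi_norm_le_iff_of_nonneg (by positivity)).2 fun i => ?_
      rw [Real.norm_eq_abs, Pi.sub_apply, abs_of_nonneg (hb0 i)]
      exact hb1 i
  refine ne_top_of_le_ne_top (condKolmogorov_ne_top hU
    (List.ofFn fun i => List.ofFn (b i)).flatten (pairString n m)) ?_
  exact (iInf₂_le u hu).trans (iInf₂_le (_ : List Bool) ⟨m, b, rfl, fun _ => rfl⟩)

theorem exists_isMCPSolution (U : List Bool → List Bool →. List Bool) {d n : ℕ} (m : ℕ)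
    (A : Matrix (Fin d) (Fin n) ℝ) {x : Fin n → ℝ} (hx : x ∈ Set.Icc (0 : Fin n → ℝ) 1) :
    ∃ z, IsMCPSolution U m A (A *ᵥ x) z := by
  obtain ⟨z, hz, hmin⟩ := exists_minimalFor_of_wellFoundedLT
    (fun z => z ∈ Set.Icc (0 : Fin n → ℝ) 1 ∧ A *ᵥ z = A *ᵥ x) (resKolmogorov U m) ⟨x, hx, rfl⟩
  exact ⟨z, hz, fun w hw hA => (le_total _ _).elim id fun h => hmin ⟨hw, hA⟩ h⟩

/-!
Write `k` for the complexity of `x₀` at resolution `m`, `δ = 2⁻ᵐ` and `x` for a solution of the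
pursuit. As `x₀` itself is feasible, `x` is within `δ` (in sup norm) of some `u` with
`K(u | n, m) ≤ k`. Halting programs are prefix-free, so there are at most `2 ^ k` such `u`
(`finite_and_ncard_vecKolmogorov_le`). Since `A x = A x₀`, the vectors `A (x₀ - u)` and `A (x - u)`
coincide, and the bound follows (`norm_sub_le_of_mulVec_eq`) once

* `‖A (x₀ - u)‖² ≥ d (1 - t) ‖x₀ - u‖²` for all these `u`: a chi-square Chernoff bound
  (`stdGaussianMatrix_sum_sq_lt_le`) and a union bound, at the cost `2 ^ k e^{d(t + log(1-t))/2}`;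
* `‖A v‖ ≤ δ √n (√n + 2√d)` for every `v` in the cube `[-δ, δ]ⁿ`, which fails with probability at
  most `e^{-d/2}` (`stdGaussianMatrix_cube_le`).

The second point does not go through the operator norm of `A`, which would require Gaussian
comparison and concentration inequalities. For `v ∈ [-1, 1]ⁿ` and a standard Gaussian vector `w` of
`ℝ^d`, independent of `A`,
`exp (l² ‖A v‖² / 2) = E_w exp (l ⟨w, A v⟩) ≤ E_w exp (l ‖Aᵀ w‖₁)`,
and the right-hand side no longer depends on `v`. Exchanging the expectations, the mean over `A` is
`E_w (E exp (l ‖w‖ |g|))ⁿ` with `g` a standard Gaussian variable, so a bound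
`E e^{x|g|} ≤ e^{α + c x²/2}` turns it into a chi-square moment of `‖w‖²`, and Markov's inequality
concludes. Two pairs `(α, c)`, according to the ratio `n / d`, are enough to reach `e^{-d/2}`.
-/

/-! ### Gaussian integrals -/

theorem lintegral_pi_prod {ι α : Type*} [Fintype ι] [MeasurableSpace α] (μ : Measure α)
    [IsProbabilityMeasure μ] {f : ι → α → ENNReal} (hf : ∀ i, Measurable (f i)) :
    ∫⁻ x, ∏ i, f i (x i) ∂(Measure.pi fun _ : ι => μ) = ∏ i, ∫⁻ a, f i a ∂μ := by
  rw [lintegral_prod_eq_prod_lintegral_of_indepFun Finset.univ (fun i (x : ι → α) => f i (x i))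
    (iIndepFun_pi fun i => (hf i).aemeasurable) fun i => (hf i).comp (measurable_pi_apply i)]
  refine Finset.prod_congr rfl fun i _ => ?_
  exact (measurePreserving_eval (fun _ : ι => μ) i).lintegral_comp (hf i)

theorem map_sum_mul_pi_gaussianReal {ι : Type*} [Fintype ι] (w : ι → ℝ) :
    (Measure.pi fun _ : ι => gaussianReal 0 1).map (fun x => ∑ i, w i * x i)
      = gaussianReal 0 (∑ i, w i ^ 2).toNNReal := by
  refine Measure.ext_of_charFun ?_
  ext s
  rw [charFun_apply_real, integral_map (Measurable.aemeasurable (by fun_prop)) (by fun_prop),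
    charFun_gaussianReal]
  have h : ∀ x : ι → ℝ, Complex.exp (s * ((∑ i, w i * x i : ℝ) : ℂ) * Complex.I)
      = ∏ i, Complex.exp (((s * w i : ℝ) : ℂ) * (x i : ℂ) * Complex.I) := by
    intro x
    rw [← Complex.exp_sum]
    congr 1
    push_cast
    rw [Finset.mul_sum, Finset.sum_mul]
    exact Finset.sum_congr rfl fun i _ => by ring
  simp_rw [h]
  rw [integral_fintype_prod_eq_prod
    (f := fun i (x : ℝ) => Complex.exp (((s * w i : ℝ) : ℂ) * (x : ℂ) * Complex.I))]
  simp_rw [← charFun_apply_real, charFun_gaussianReal]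
  rw [← Complex.exp_sum]
  congr 1
  rw [Real.coe_toNNReal _ (Finset.sum_nonneg fun i _ => sq_nonneg _)]
  push_cast
  simp only [mul_zero, zero_mul, zero_sub, one_mul]
  rw [Finset.sum_neg_distrib, ← Finset.sum_div, Finset.sum_mul]
  congr 2
  exact Finset.sum_congr rfl fun i _ => by ring

/-- If the rows of a matrix are independent standard Gaussian vectors, its products with a fixed
vector `w` are independent centred Gaussians of variance `‖w‖²`. -/
theorem lintegral_prod_rows {κ ι : Type*} [Fintype κ] [Fintype ι] (w : ι → ℝ)
    {F : ℝ → ENNReal} (hF : Measurable F) :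
    ∫⁻ X, ∏ k, F (∑ i, w i * X k i)
        ∂(Measure.pi fun _ : κ => Measure.pi fun _ : ι => gaussianReal 0 1)
      = (∫⁻ y, F y ∂gaussianReal 0 (∑ i, w i ^ 2).toNNReal) ^ Fintype.card κ := by
  rw [lintegral_pi_prod (Measure.pi fun _ : ι => gaussianReal 0 1)
    (f := fun _ (x : ι → ℝ) => F (∑ i, w i * x i)) (fun _ => by fun_prop),
    ← map_sum_mul_pi_gaussianReal w, lintegral_map hF (by fun_prop), Finset.prod_const,
    Finset.card_univ]

theorem lintegral_gaussianReal_eq_std (v : ℝ) (hv : 0 ≤ v) {F : ℝ → ENNReal} (hF : Measurable F) :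
    ∫⁻ y, F y ∂gaussianReal 0 v.toNNReal = ∫⁻ y, F (√v * y) ∂gaussianReal 0 1 := by
  have h := gaussianReal_map_const_mul (μ := 0) (v := 1) (√v)
  have h2 : (⟨√v ^ 2, sq_nonneg _⟩ : NNReal) * 1 = v.toNNReal := by
    ext
    simp [Real.sq_sqrt hv, hv]
  rw [mul_zero] at h
  erw [h2] at h
  rw [← h, lintegral_map hF (by fun_prop)]

theorem lintegral_exp_sq_gaussianReal {b : ℝ} (hb : b < 1) :
    ∫⁻ y, ENNReal.ofReal (Real.exp (b * y ^ 2 / 2)) ∂gaussianReal 0 1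
      = ENNReal.ofReal (√(1 - b))⁻¹ := by
  rw [gaussianReal_of_var_ne_zero _ one_ne_zero,
    lintegral_withDensity_eq_lintegral_mul _ (measurable_gaussianPDF _ _) (by fun_prop)]
  have h : ∀ y : ℝ, (gaussianPDF 0 1 * fun y => ENNReal.ofReal (Real.exp (b * y ^ 2 / 2))) y
      = ENNReal.ofReal ((√(2 * Real.pi))⁻¹ * Real.exp (-((1 - b) / 2) * y ^ 2)) := by
    intro y
    rw [Pi.mul_apply, gaussianPDF, ← ENNReal.ofReal_mul (gaussianPDFReal_nonneg _ _ _),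
      gaussianPDFReal, mul_assoc, ← Real.exp_add]
    simp only [NNReal.coe_one, mul_one, sub_zero]
    congr 3
    ring
  simp_rw [h]
  rw [← ofReal_integral_eq_lintegral_ofReal
    ((integrable_exp_neg_mul_sq (by linarith)).const_mul _)
    (Filter.Eventually.of_forall fun y => by positivity), integral_const_mul, integral_gaussian]
  congr 1
  rw [← Real.sqrt_inv, ← Real.sqrt_inv, ← Real.sqrt_mul (by positivity)]
  congr 1
  have : 1 - b ≠ 0 := by linarith
  field_simp

/-- The exponential moment of `‖w‖²` for a standard Gaussian vector `w`. -/
theorem lintegral_exp_sum_sq_pi_gaussianReal {ι : Type*} [Fintype ι] {b : ℝ} (hb : b < 1) :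
    ∫⁻ w, ENNReal.ofReal (Real.exp (b * (∑ i, w i ^ 2) / 2))
        ∂(Measure.pi fun _ : ι => gaussianReal 0 1)
      = ENNReal.ofReal (√(1 - b))⁻¹ ^ Fintype.card ι := by
  have h : ∀ w : ι → ℝ, ENNReal.ofReal (Real.exp (b * (∑ i, w i ^ 2) / 2))
      = ∏ i, ENNReal.ofReal (Real.exp (b * w i ^ 2 / 2)) := by
    intro w
    rw [← ENNReal.ofReal_prod_of_nonneg fun i _ => (Real.exp_pos _).le, ← Real.exp_sum,
      Finset.mul_sum, Finset.sum_div]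
  simp_rw [h]
  rw [lintegral_pi_prod (gaussianReal 0 1)
    (f := fun _ (y : ℝ) => ENNReal.ofReal (Real.exp (b * y ^ 2 / 2))) (fun _ => by fun_prop),
    lintegral_exp_sq_gaussianReal hb, Finset.prod_const, Finset.card_univ]

theorem lintegral_exp_mul_gaussianReal (x : ℝ) (v : NNReal) :
    ∫⁻ y, ENNReal.ofReal (Real.exp (x * y)) ∂gaussianReal 0 v
      = ENNReal.ofReal (Real.exp (v * x ^ 2 / 2)) := by
  rw [← ofReal_integral_eq_lintegral_ofReal (integrable_exp_mul_gaussianReal x)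
    (Filter.Eventually.of_forall fun y => (Real.exp_pos _).le)]
  have := congrFun (mgf_fun_id_gaussianReal (μ := 0) (v := v)) x
  rw [mgf] at this
  rw [this]
  simp

/-- Completing the square: `E e^{xg} 1_{g ≥ 0} = e^{x²/2} P(g ≥ -x)`, bounded here using
`P(g ≥ 0) = 1/2` and the fact that the Gaussian density is at most `1/√(2π) ≤ 2/5`. -/
theorem lintegral_Ici_exp_mul_gaussianReal_le {x : ℝ} (hx : 0 ≤ x) :
    ∫⁻ y in Set.Ici 0, ENNReal.ofReal (Real.exp (x * y)) ∂gaussianReal 0 1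
      ≤ ENNReal.ofReal (Real.exp (x ^ 2 / 2) * (1 / 2 + 2 / 5 * x)) := by
  rw [gaussianReal_of_var_ne_zero _ one_ne_zero,
    setLIntegral_withDensity_eq_setLIntegral_mul _ (measurable_gaussianPDF _ _) (by fun_prop)
      measurableSet_Ici]
  have h : ∀ y : ℝ, (gaussianPDF 0 1 * fun y => ENNReal.ofReal (Real.exp (x * y))) y
      = ENNReal.ofReal (Real.exp (x ^ 2 / 2) * gaussianPDFReal 0 1 (y - x)) := by
    intro y
    rw [Pi.mul_apply, gaussianPDF, ← ENNReal.ofReal_mul (gaussianPDFReal_nonneg _ _ _)]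
    simp only [gaussianPDFReal, NNReal.coe_one, mul_one, sub_zero]
    rw [mul_assoc, ← Real.exp_add, mul_left_comm, ← Real.exp_add]
    congr 3
    ring
  have hint : Integrable fun y => gaussianPDFReal 0 1 y := integrable_gaussianPDFReal 0 1
  have hint' : Integrable fun y => gaussianPDFReal 0 1 (y - x) := hint.comp_sub_right x
  simp_rw [h]
  rw [← ofReal_integral_eq_lintegral_ofReal ((hint'.const_mul _).integrableOn)
    (Filter.Eventually.of_forall fun y => mul_nonneg (Real.exp_pos _).le
      (gaussianPDFReal_nonneg _ _ _)), integral_const_mul]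
  refine ENNReal.ofReal_le_ofReal (mul_le_mul_of_nonneg_left ?_ (Real.exp_pos _).le)
  have hhalf : ∫ y in Set.Ioi 0, gaussianPDFReal 0 1 y = 1 / 2 := by
    simp only [gaussianPDFReal, NNReal.coe_one, mul_one, sub_zero]
    rw [integral_const_mul]
    have := integral_gaussian_Ioi (1 / 2)
    have e : ∀ y : ℝ, -y ^ 2 / 2 = -(1 / 2) * y ^ 2 := fun y => by ring
    simp_rw [e]
    rw [this, div_div_eq_mul_div, div_one, mul_comm Real.pi]
    have : √(2 * Real.pi) ≠ 0 := by positivity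
    field_simp
  have hsplit : ∫ y in Set.Ici 0, gaussianPDFReal 0 1 (y - x)
      = (∫ y in (-x)..0, gaussianPDFReal 0 1 y) + ∫ y in Set.Ioi 0, gaussianPDFReal 0 1 y := by
    rw [intervalIntegral.integral_interval_add_Ioi hint.integrableOn hint.integrableOn,
      integral_Ici_eq_integral_Ioi]
    rw [← integral_indicator measurableSet_Ioi, ← integral_indicator measurableSet_Ioi,
      
      ← integral_sub_right_eq_self ((Set.Ioi (-x)).indicator fun y => gaussianPDFReal 0 1 y) x]
    congr 1
    ext y
    simp [Set.indicator, Set.mem_Ioi]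
  have hpdf : ∀ y : ℝ, gaussianPDFReal 0 1 y ≤ 2 / 5 := by
    intro y
    have hs : (5 / 2 : ℝ) ≤ √(2 * Real.pi) := by
      refine Real.le_sqrt_of_sq_le ?_
      have := Real.pi_gt_d2
      norm_num at this ⊢
      linarith
    simp only [gaussianPDFReal, NNReal.coe_one, mul_one, sub_zero]
    calc (√(2 * Real.pi))⁻¹ * Real.exp (-y ^ 2 / 2) ≤ (5 / 2)⁻¹ * 1 := by
          gcongr
          rw [Real.exp_le_one_iff]
          nlinarith [sq_nonneg y]
      _ = 2 / 5 := by norm_num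
  have hI : ∫ y in (-x)..0, gaussianPDFReal 0 1 y ≤ 2 / 5 * x := by
    have := intervalIntegral.integral_mono_on (a := -x) (b := 0) (by linarith)
      (hint.intervalIntegrable) (intervalIntegrable_const (c := (2 / 5 : ℝ)))
      fun y _ => hpdf y
    refine this.trans (le_of_eq ?_)
    rw [intervalIntegral.integral_const, smul_eq_mul]
    ring
  rw [hsplit, hhalf]
  linarith

theorem lintegral_exp_mul_abs_gaussianReal_le_two_mul {x : ℝ} :
    ∫⁻ y, ENNReal.ofReal (Real.exp (x * |y|)) ∂gaussianReal 0 1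
      ≤ ENNReal.ofReal (2 * Real.exp (x ^ 2 / 2)) := by
  calc ∫⁻ y, ENNReal.ofReal (Real.exp (x * |y|)) ∂gaussianReal 0 1
      ≤ ∫⁻ y, (ENNReal.ofReal (Real.exp (x * y)) + ENNReal.ofReal (Real.exp (-x * y)))
          ∂gaussianReal 0 1 := by
        refine lintegral_mono fun y => ?_
        rcases abs_cases y with ⟨h, _⟩ | ⟨h, _⟩ <;> rw [h]
        · exact le_self_add
        · rw [mul_neg, ← neg_mul]
          exact le_add_self
    _ = _ := by
        rw [lintegral_add_left (by fun_prop), lintegral_exp_mul_gaussianReal,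
          lintegral_exp_mul_gaussianReal, ← ENNReal.ofReal_add (by positivity) (by positivity),
          two_mul]
        simp

theorem lintegral_exp_mul_abs_gaussianReal_le_one_add {x : ℝ} (hx : 0 ≤ x) :
    ∫⁻ y, ENNReal.ofReal (Real.exp (x * |y|)) ∂gaussianReal 0 1
      ≤ ENNReal.ofReal (Real.exp (x ^ 2 / 2) * (1 + 4 / 5 * x)) := by
  have hneg : ∫⁻ y in Set.Iio 0, ENNReal.ofReal (Real.exp (x * |y|)) ∂gaussianReal 0 1
      ≤ ∫⁻ y in Set.Ici 0, ENNReal.ofReal (Real.exp (x * |y|)) ∂gaussianReal 0 1 := by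
    have hmap : (gaussianReal 0 1).map (fun y : ℝ => -y) = gaussianReal 0 1 := by
      rw [gaussianReal_map_neg, neg_zero]
    conv_rhs => rw [← hmap]
    rw [setLIntegral_map measurableSet_Ici (by fun_prop) (by fun_prop)]
    simp_rw [abs_neg]
    refine lintegral_mono_set fun y hy => ?_
    simpa using (show y < 0 from hy).le
  have hpos : ∫⁻ y in Set.Ici 0, ENNReal.ofReal (Real.exp (x * |y|)) ∂gaussianReal 0 1
      ≤ ENNReal.ofReal (Real.exp (x ^ 2 / 2) * (1 / 2 + 2 / 5 * x)) := by
    refine le_trans (le_of_eq ?_) (lintegral_Ici_exp_mul_gaussianReal_le hx)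
    refine setLIntegral_congr_fun measurableSet_Ici fun y hy => ?_
    simp only [abs_of_nonneg (show 0 ≤ y from hy)]
  rw [← lintegral_add_compl _ (measurableSet_Ici (a := (0 : ℝ))), Set.compl_Ici]
  refine (add_le_add hpos (hneg.trans hpos)).trans (le_of_eq ?_)
  rw [← ENNReal.ofReal_add (by positivity) (by positivity)]
  congr 1
  ring

/-! ### Standard Gaussian matrices -/

/-- The law of a `κ × ι` matrix with independent standard Gaussian entries, the matrix being given
as the family of its rows. -/
noncomputable def stdGaussianMatrix (κ ι : Type*) [Fintype κ] [Fintype ι] :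
    Measure (κ → ι → ℝ) :=
  Measure.pi fun _ : κ => Measure.pi fun _ : ι => gaussianReal 0 1

instance (κ ι : Type*) [Fintype κ] [Fintype ι] : IsProbabilityMeasure (stdGaussianMatrix κ ι) := by
  unfold stdGaussianMatrix
  infer_instance

theorem hasLaw_stdGaussianMatrix {κ ι Ω : Type*} [Fintype κ] [Fintype ι] [MeasurableSpace Ω]
    {P : Measure Ω} {X : κ → ι → Ω → ℝ} (hlaw : ∀ k i, HasLaw (X k i) (gaussianReal 0 1) P)
    (hindep : iIndepFun (fun (ki : κ × ι) => X ki.1 ki.2) P) :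
    HasLaw (fun ω k i => X k i ω) (stdGaussianMatrix κ ι) P := by
  have h := hindep.hasLaw_pi (μ := fun _ => gaussianReal 0 1) fun ki : κ × ι => hlaw ki.1 ki.2
  have hc := Measure.infinitePi_map_curry fun (_ : κ) (_ : ι) => gaussianReal 0 1
  simp only [Measure.infinitePi_eq_pi] at hc
  exact HasLaw.comp ⟨by fun_prop, hc⟩ h

/-- Chernoff bound for the lower tail of the chi-square law of `‖X z‖² / ‖z‖²`. -/
theorem stdGaussianMatrix_sum_sq_lt_le {κ ι : Type*} [Fintype κ] [Fintype ι] (z : ι → ℝ) {t : ℝ}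
    (ht : t ∈ Set.Ioo (0 : ℝ) 1) :
    stdGaussianMatrix κ ι {X | ∑ k, (∑ i, z i * X k i) ^ 2
        < Fintype.card κ * (1 - t) * ∑ i, z i ^ 2}
      ≤ ENNReal.ofReal (Real.exp ((Fintype.card κ : ℝ) / 2 * (t + Real.log (1 - t)))) := by
  obtain ⟨ht0, ht1⟩ := ht
  have hZ : 0 ≤ ∑ i, z i ^ 2 := Finset.sum_nonneg fun i _ => sq_nonneg _
  rcases hZ.eq_or_lt with h0 | hpos
  · have : {X : κ → ι → ℝ | ∑ k, (∑ i, z i * X k i) ^ 2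
        < Fintype.card κ * (1 - t) * ∑ i, z i ^ 2} = ∅ := by
      refine Set.eq_empty_of_forall_notMem fun X hX => ?_
      rw [Set.mem_ofPred_eq, ← h0, mul_zero] at hX
      exact hX.not_ge (Finset.sum_nonneg fun k _ => sq_nonneg _)
    rw [this, measure_empty]
    exact zero_le
  set Z := ∑ i, z i ^ 2 with hZdef
  set d := Fintype.card κ
  have h1t : 0 < 1 - t := by linarith
  -- The exponent that minimises the Chernoff bound.
  set b : ℝ := -(t / ((1 - t) * Z)) with hb
  have hbZ : b * Z = -(t / (1 - t)) := by rw [hb]; field_simp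
  have hmoment : ∫⁻ X, ∏ k, ENNReal.ofReal (Real.exp (b * (∑ i, z i * X k i) ^ 2 / 2))
      ∂stdGaussianMatrix κ ι = ENNReal.ofReal (√(1 - t)) ^ d := by
    rw [stdGaussianMatrix, lintegral_prod_rows z
      (F := fun y => ENNReal.ofReal (Real.exp (b * y ^ 2 / 2))) (by fun_prop),
      lintegral_gaussianReal_eq_std _ hZ (by fun_prop)]
    have e : ∀ y : ℝ, b * (√Z * y) ^ 2 / 2 = (b * Z) * y ^ 2 / 2 := fun y => by
      rw [mul_pow, Real.sq_sqrt hZ]; ring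
    simp_rw [e]
    rw [hbZ, lintegral_exp_sq_gaussianReal (by have := div_pos ht0 h1t; linarith)]
    congr 2
    rw [← Real.sqrt_inv]
    congr 1
    field_simp
    ring
  have hsub : {X : κ → ι → ℝ | ∑ k, (∑ i, z i * X k i) ^ 2 < d * (1 - t) * Z} ⊆
      {X | ENNReal.ofReal (Real.exp (-(d * t / 2)))
        ≤ ∏ k, ENNReal.ofReal (Real.exp (b * (∑ i, z i * X k i) ^ 2 / 2))} := by
    intro X hX
    rw [Set.mem_ofPred_eq] at hX ⊢
    rw [← ENNReal.ofReal_prod_of_nonneg fun k _ => (Real.exp_pos _).le, ← Real.exp_sum,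
      ← Finset.sum_div, ← Finset.mul_sum]
    refine ENNReal.ofReal_le_ofReal (Real.exp_le_exp.2 ?_)
    have hb0 : b ≤ 0 := by rw [hb]; exact neg_nonpos.2 (by positivity)
    have h2 := mul_le_mul_of_nonpos_left hX.le hb0
    have h3 : b * (d * (1 - t) * Z) = -(d * t) := by
      rw [hb]; field_simp
    linarith
  refine (measure_mono hsub).trans ?_
  refine (meas_ge_le_lintegral_div (Measurable.aemeasurable (by fun_prop))
    (ENNReal.ofReal_pos.2 (Real.exp_pos _)).ne' ENNReal.ofReal_ne_top).trans ?_
  rw [hmoment, ← ENNReal.ofReal_pow (Real.sqrt_nonneg _),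
    ← ENNReal.ofReal_div_of_pos (Real.exp_pos _)]
  refine ENNReal.ofReal_le_ofReal (le_of_eq ?_)
  rw [← Real.exp_log (Real.sqrt_pos.2 h1t), ← Real.exp_nat_mul, ← Real.exp_sub,
    Real.log_sqrt h1t.le]
  congr 1
  ring

/-! ### The image of a cube under a Gaussian matrix -/

/-- For a matrix with columns `X j`, the average over a standard Gaussian vector `w` of
`exp (l * ‖Xᵀ w‖₁)`. It dominates `exp (l² ‖X v‖² / 2)` for every `v` in the cube `[-1, 1]^ι`. -/
noncomputable def cubeFunctional {κ ι : Type*} [Fintype κ] [Fintype ι] (l : ℝ) (X : ι → κ → ℝ) :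
    ENNReal :=
  ∫⁻ w, ∏ j, ENNReal.ofReal (Real.exp (l * |∑ i, w i * X j i|))
    ∂(Measure.pi fun _ : κ => gaussianReal 0 1)

theorem measurable_cubeFunctional {κ ι : Type*} [Fintype κ] [Fintype ι] (l : ℝ) :
    Measurable (cubeFunctional (κ := κ) (ι := ι) l) := by
  refine Measurable.lintegral_prod_right' (f := fun p : (ι → κ → ℝ) × (κ → ℝ) =>
    ∏ j, ENNReal.ofReal (Real.exp (l * |∑ i, p.2 i * p.1 j i|))) ?_
  fun_prop

/-- Linearisation of the square by a Gaussian average: `exp (l² ‖y‖² / 2)` is the mean of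
`exp (l ⟨w, y⟩)`, and `⟨w, X v⟩ ≤ ‖Xᵀ w‖₁` for `v` in the cube. -/
theorem exp_le_cubeFunctional {κ ι : Type*} [Fintype κ] [Fintype ι] {l : ℝ} (hl : 0 ≤ l)
    (X : ι → κ → ℝ) {v : ι → ℝ} (hv : ∀ j, |v j| ≤ 1) :
    ENNReal.ofReal (Real.exp (l ^ 2 * (∑ i, (∑ j, X j i * v j) ^ 2) / 2))
      ≤ cubeFunctional l X := by
  set y : κ → ℝ := fun i => ∑ j, X j i * v j with hy
  have h : ENNReal.ofReal (Real.exp (l ^ 2 * (∑ i, y i ^ 2) / 2))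
      = ∫⁻ w, ∏ i, ENNReal.ofReal (Real.exp ((l * y i) * w i))
          ∂(Measure.pi fun _ : κ => gaussianReal 0 1) := by
    rw [lintegral_pi_prod (gaussianReal 0 1)
      (f := fun i (a : ℝ) => ENNReal.ofReal (Real.exp ((l * y i) * a))) (fun _ => by fun_prop)]
    simp_rw [lintegral_exp_mul_gaussianReal]
    rw [← ENNReal.ofReal_prod_of_nonneg fun i _ => (Real.exp_pos _).le, ← Real.exp_sum,
      Finset.mul_sum, Finset.sum_div]
    congr 2
    exact Finset.sum_congr rfl fun i _ => by push_cast; ring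
  rw [h]
  refine lintegral_mono fun w => ?_
  dsimp only
  rw [← ENNReal.ofReal_prod_of_nonneg fun i _ => (Real.exp_pos _).le,
    ← ENNReal.ofReal_prod_of_nonneg fun i _ => (Real.exp_pos _).le, ← Real.exp_sum, ← Real.exp_sum]
  refine ENNReal.ofReal_le_ofReal (Real.exp_le_exp.2 ?_)
  have hswap : ∑ i, l * y i * w i = ∑ j, l * ((∑ i, w i * X j i) * v j) := by
    simp only [hy, Finset.mul_sum, Finset.sum_mul]
    rw [Finset.sum_comm]
    exact Finset.sum_congr rfl fun j _ => Finset.sum_congr rfl fun i _ => by ring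
  rw [hswap]
  refine Finset.sum_le_sum fun j _ => mul_le_mul_of_nonneg_left ?_ hl
  calc (∑ i, w i * X j i) * v j ≤ |(∑ i, w i * X j i) * v j| := le_abs_self _
    _ = |∑ i, w i * X j i| * |v j| := abs_mul _ _
    _ ≤ |∑ i, w i * X j i| := mul_le_of_le_one_right (abs_nonneg _) (hv j)

/-- A Gaussian-type bound `exp (α + c x² / 2)` for `E e^{x|g|}` controls the mean of
`cubeFunctional`: given `w`, the coordinates of `Xᵀ w` are independent of variance `‖w‖²`. -/
theorem lintegral_cubeFunctional_le {κ ι : Type*} [Fintype κ] [Fintype ι] {l α c : ℝ}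
    (hl : 0 ≤ l) (hq : Fintype.card ι * c * l ^ 2 < 1)
    (H : ∀ x : ℝ, 0 ≤ x → ∫⁻ y, ENNReal.ofReal (Real.exp (x * |y|)) ∂gaussianReal 0 1
      ≤ ENNReal.ofReal (Real.exp (α + c * x ^ 2 / 2))) :
    ∫⁻ X, cubeFunctional (κ := κ) l X ∂stdGaussianMatrix ι κ
      ≤ ENNReal.ofReal (Real.exp (Fintype.card ι * α))
        * ENNReal.ofReal (√(1 - Fintype.card ι * c * l ^ 2))⁻¹ ^ Fintype.card κ := by
  unfold cubeFunctional
  rw [lintegral_lintegral_swap (Measurable.aemeasurable (by fun_prop))]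
  set n := Fintype.card ι
  calc ∫⁻ w, ∫⁻ X, ∏ j, ENNReal.ofReal (Real.exp (l * |∑ i, w i * X j i|))
          ∂stdGaussianMatrix ι κ ∂(Measure.pi fun _ : κ => gaussianReal 0 1)
      ≤ ∫⁻ w, ENNReal.ofReal (Real.exp (n * α))
          * ENNReal.ofReal (Real.exp (n * c * l ^ 2 * (∑ i, w i ^ 2) / 2))
          ∂(Measure.pi fun _ : κ => gaussianReal 0 1) := by
        refine lintegral_mono fun w => ?_
        dsimp only
        have hW : 0 ≤ ∑ i, w i ^ 2 := Finset.sum_nonneg fun i _ => sq_nonneg _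
        rw [stdGaussianMatrix, lintegral_prod_rows w
          (F := fun y => ENNReal.ofReal (Real.exp (l * |y|))) (by fun_prop),
          lintegral_gaussianReal_eq_std _ hW (by fun_prop)]
        have e : ∀ y : ℝ, l * |√(∑ i, w i ^ 2) * y| = (l * √(∑ i, w i ^ 2)) * |y| := fun y => by
          rw [abs_mul, abs_of_nonneg (Real.sqrt_nonneg _), mul_assoc]
        simp_rw [e]
        refine (pow_le_pow_left₀ zero_le (H _ (by positivity)) _).trans (le_of_eq ?_)
        rw [← ENNReal.ofReal_pow (Real.exp_pos _).le, ← ENNReal.ofReal_mul (Real.exp_pos _).le,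
          ← Real.exp_nat_mul, ← Real.exp_add, mul_pow, Real.sq_sqrt hW]
        congr 2
        ring
    _ = _ := by
        rw [lintegral_const_mul _ (by fun_prop), lintegral_exp_sum_sq_pi_gaussianReal hq]

/-- The constants used to bound `E e^{x|g|}`: the factor `2` is efficient when `n ≤ 16 d`, the
linear factor `1 + 4x/5` for larger `n`. The number `1 - e⁻²` is the value of `n c l²` at which
`lintegral_cubeFunctional_le` is applied. -/
theorem exists_exp_mul_abs_bound (d n : ℕ) :
    ∃ α c : ℝ, 0 < c ∧
      (∀ x : ℝ, 0 ≤ x → ∫⁻ y, ENNReal.ofReal (Real.exp (x * |y|)) ∂gaussianReal 0 1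
        ≤ ENNReal.ofReal (Real.exp (α + c * x ^ 2 / 2))) ∧
      n * α + d - (1 - Real.exp (-2)) * (√n + 2 * √d) ^ 2 / (2 * c) ≤ -((d : ℝ) / 2) := by
  have hq : (0.86 : ℝ) ≤ 1 - Real.exp (-2) := by
    have h1 := Real.exp_one_gt_d9
    have h2 : Real.exp 2 = Real.exp 1 * Real.exp 1 := by rw [← Real.exp_add]; norm_num
    have h3 : (7.2 : ℝ) ≤ Real.exp 2 := by rw [h2]; nlinarith
    rw [Real.exp_neg]
    have h4 : (Real.exp 2)⁻¹ ≤ (7.2 : ℝ)⁻¹ := inv_anti₀ (by norm_num) h3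
    norm_num at h4 ⊢
    linarith
  set q := 1 - Real.exp (-2)
  have hx := Real.sqrt_nonneg (n : ℝ)
  have hy := Real.sqrt_nonneg (d : ℝ)
  have hn : (n : ℝ) = √n ^ 2 := (Real.sq_sqrt (Nat.cast_nonneg n)).symm
  have hd : (d : ℝ) = √d ^ 2 := (Real.sq_sqrt (Nat.cast_nonneg d)).symm
  set x := √(n : ℝ)
  set y := √(d : ℝ)
  have hqs : 0.86 * (x + 2 * y) ^ 2 ≤ q * (x + 2 * y) ^ 2 :=
    mul_le_mul_of_nonneg_right hq (sq_nonneg _)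
  rcases le_total x (4 * y) with h | h
  · refine ⟨Real.log 2, 1, one_pos, fun a _ => ?_, ?_⟩
    · refine lintegral_exp_mul_abs_gaussianReal_le_two_mul.trans (le_of_eq ?_)
      rw [Real.exp_add, Real.exp_log two_pos, one_mul]
    · have hl := mul_le_mul_of_nonneg_left Real.log_two_lt_d9.le (sq_nonneg x)
      rw [hn, hd]
      nlinarith [mul_le_mul_of_nonneg_left h hx, mul_nonneg hx hy, sq_nonneg y]
  · refine ⟨2 / 25, 5, by norm_num, fun a ha => ?_, ?_⟩
    · refine (lintegral_exp_mul_abs_gaussianReal_le_one_add ha).trans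
        (ENNReal.ofReal_le_ofReal ?_)
      have h1 : 1 + 4 / 5 * a ≤ Real.exp (4 / 5 * a) := by
        linarith [Real.add_one_le_exp (4 / 5 * a)]
      refine (mul_le_mul_of_nonneg_left h1 (Real.exp_pos _).le).trans ?_
      rw [← Real.exp_add, Real.exp_le_exp]
      -- `4a/5 ≤ 2/25 + 2a²`, with equality at `a = 1/5`
      nlinarith [sq_nonneg (a - 1 / 5)]
    · rw [hn, hd]
      nlinarith [mul_le_mul_of_nonneg_right h hy, mul_le_mul_of_nonneg_left h hx]

/-- With probability at least `1 - e^{-d/2}`, a Gaussian matrix with `n` columns in `ℝ^d` maps the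
cube `[-δ, δ]^n` into the ball of radius `δ √n (√n + 2√d)`. -/
theorem stdGaussianMatrix_cube_le {κ ι : Type*} [Fintype κ] [Fintype ι] [Nonempty ι]
    {δ : ℝ} (hδ : 0 < δ) :
    stdGaussianMatrix ι κ {X | ∃ v : ι → ℝ, (∀ j, |v j| ≤ δ) ∧
        δ ^ 2 * Fintype.card ι * (√(Fintype.card ι : ℝ) + 2 * √(Fintype.card κ : ℝ)) ^ 2
          < ∑ i, (∑ j, X j i * v j) ^ 2}
      ≤ ENNReal.ofReal (Real.exp (-((Fintype.card κ : ℝ) / 2))) := by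
  obtain ⟨α, c, hc, H, hnum⟩ := exists_exp_mul_abs_bound (Fintype.card κ) (Fintype.card ι)
  have hn : (0 : ℝ) < Fintype.card ι := Nat.cast_pos.2 Fintype.card_pos
  have hq0 : 0 < 1 - Real.exp (-2) := by
    rw [sub_pos, Real.exp_lt_one_iff]
    norm_num
  set n := Fintype.card ι
  set d := Fintype.card κ
  set q := 1 - Real.exp (-2) with hq
  set l := √(q / (n * c)) with hl
  have hl2 : l ^ 2 = q / (n * c) := Real.sq_sqrt (by positivity)
  have hncl : n * c * l ^ 2 = q := by rw [hl2]; field_simp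
  set s := q * (√(n : ℝ) + 2 * √(d : ℝ)) ^ 2 / (2 * c) with hs
  have hsub : {X : ι → κ → ℝ | ∃ v : ι → ℝ, (∀ j, |v j| ≤ δ) ∧
        δ ^ 2 * n * (√(n : ℝ) + 2 * √(d : ℝ)) ^ 2 < ∑ i, (∑ j, X j i * v j) ^ 2}
      ⊆ {X | ENNReal.ofReal (Real.exp s) ≤ cubeFunctional l X} := by
    rintro X ⟨v, hv, hlt⟩
    have hv' : ∀ j, |v j / δ| ≤ 1 := fun j => by
      rw [abs_div, abs_of_pos hδ]
      exact (div_le_one hδ).2 (hv j)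
    refine le_trans (ENNReal.ofReal_le_ofReal (Real.exp_le_exp.2 ?_))
      (exp_le_cubeFunctional (Real.sqrt_nonneg _) X hv')
    have e : ∑ i, (∑ j, X j i * (v j / δ)) ^ 2 = (∑ i, (∑ j, X j i * v j) ^ 2) / δ ^ 2 := by
      rw [Finset.sum_div]
      refine Finset.sum_congr rfl fun i _ => ?_
      rw [← div_pow, Finset.sum_div]
      simp_rw [mul_div_assoc]
    rw [e, hl2]
    have h1 : n * (√(n : ℝ) + 2 * √(d : ℝ)) ^ 2 ≤ (∑ i, (∑ j, X j i * v j) ^ 2) / δ ^ 2 := by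
      rw [le_div_iff₀ (by positivity)]
      linarith
    have h2 : s = q / (n * c) * (n * (√(n : ℝ) + 2 * √(d : ℝ)) ^ 2) / 2 := by
      rw [hs]; field_simp
    rw [h2]
    gcongr
  refine (measure_mono hsub).trans ?_
  refine (meas_ge_le_lintegral_div (measurable_cubeFunctional l).aemeasurable
    (ENNReal.ofReal_pos.2 (Real.exp_pos _)).ne' ENNReal.ofReal_ne_top).trans ?_
  have hE := lintegral_cubeFunctional_le (κ := κ) (ι := ι) (Real.sqrt_nonneg _ : 0 ≤ l)
    (by rw [hncl, hq]; linarith [Real.exp_pos (-2)]) H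
  refine (ENNReal.div_le_div_right hE _).trans ?_
  have hroot : (√(1 - n * c * l ^ 2))⁻¹ = Real.exp 1 := by
    rw [hncl, hq, sub_sub_cancel, ← Real.sqrt_inv, ← Real.exp_neg, neg_neg,
      Real.sqrt_eq_iff_mul_self_eq (Real.exp_pos _).le
      (Real.exp_pos _).le, ← Real.exp_add]
    norm_num
  rw [hroot, ← ENNReal.ofReal_pow (Real.exp_pos _).le, ← ENNReal.ofReal_mul (Real.exp_pos _).le,
    ← ENNReal.ofReal_div_of_pos (Real.exp_pos _)]
  refine ENNReal.ofReal_le_ofReal ?_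
  rw [← Real.exp_nat_mul, ← Real.exp_add, ← Real.exp_sub, Real.exp_le_exp]
  linarith

/-! ### Counting vectors of bounded complexity -/

theorem exists_le_of_iInf₂_le_natCast {α : Type*} {p : α → Prop} {f : α → ℕ∞} {k : ℕ}
    (h : ⨅ (a : α) (_ : p a), f a ≤ (k : ℕ∞)) : ∃ a, p a ∧ f a ≤ k := by
  have h1 : ⨅ (a : α) (_ : p a), f a < (k : ℕ∞) + 1 :=
    (ENat.lt_add_one_iff (ENat.natCast_ne_top k)).2 h
  obtain ⟨a, ha⟩ := iInf_lt_iff.1 h1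
  obtain ⟨hp, ha⟩ := iInf_lt_iff.1 ha
  exact ⟨a, hp, (ENat.lt_add_one_iff (ENat.natCast_ne_top k)).1 ha⟩

/-- For `n > 0` the length of a binary representation determines the precision of its blocks, so
that the string determines the vector. -/
theorem IsBinaryRep.unique {n : ℕ} (hn : 0 < n) {s : List Bool} {u u' : Fin n → ℝ}
    (h : IsBinaryRep s u) (h' : IsBinaryRep s u') : u = u' := by
  obtain ⟨ℓ, b, hs, hu⟩ := h
  obtain ⟨ℓ', b', hs', hu'⟩ := h'
  have hlen : ∀ (ℓ : ℕ) (b : Fin n → Fin ℓ → Bool),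
      (List.ofFn fun i => List.ofFn (b i)).flatten.length = n * ℓ := fun ℓ b => by
    simp [List.length_flatten, List.map_ofFn, Function.comp_def]
  have hℓ : ℓ = ℓ' := by
    refine Nat.eq_of_mul_eq_mul_left hn ?_
    rw [← hlen ℓ b, ← hlen ℓ' b', ← hs, ← hs']
  subst hℓ
  have hb : b = b' := by
    have h2 := List.eq_iff_flatten_eq.2 ⟨hs.symm.trans hs', by
      simp [List.map_ofFn, Function.comp_def]⟩
    funext i
    exact List.ofFn_injective (congrFun (List.ofFn_injective h2) i)
  funext i
  rw [hu, hu', hb]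

theorem exists_program_of_vecKolmogorov_le {U : List Bool → List Bool →. List Bool} {n m k : ℕ}
    {u : Fin n → ℝ} (h : vecKolmogorov U m u ≤ k) :
    ∃ p s, IsBinaryRep s u ∧ s ∈ U p (pairString n m) ∧ p.length ≤ k := by
  obtain ⟨s, hs, hk⟩ := exists_le_of_iInf₂_le_natCast h
  obtain ⟨p, hp, hk⟩ := exists_le_of_iInf₂_le_natCast hk
  exact ⟨p, s, hs, hp, Nat.cast_le.1 hk⟩

/-- Halting programs of length at most `k` form a prefix-free set, so padding them to length `k`
is injective; hence there are at most `2 ^ k` of them. -/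
theorem finite_and_ncard_vecKolmogorov_le {U : List Bool → List Bool →. List Bool}
    (hU : IsPrefixMachine U) {n : ℕ} (hn : 0 < n) (m k : ℕ) :
    {u : Fin n → ℝ | vecKolmogorov U m u ≤ k}.Finite ∧
      {u : Fin n → ℝ | vecKolmogorov U m u ≤ k}.ncard ≤ 2 ^ k := by
  choose p s hs hp hk using fun u : {u : Fin n → ℝ | vecKolmogorov U m u ≤ k} =>
    exists_program_of_vecKolmogorov_le u.2
  let f : {u : Fin n → ℝ | vecKolmogorov U m u ≤ k} → List.Vector Bool k := fun u =>
    ⟨p u ++ List.replicate (k - (p u).length) false, by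
      simpa using Nat.add_sub_cancel' (hk u)⟩
  have hf : Function.Injective f := by
    intro u u' h
    have h1 : p u ++ List.replicate (k - (p u).length) false
        = p u' ++ List.replicate (k - (p u').length) false := congrArg Subtype.val h
    have hdom := (Part.dom_iff_mem.2 ⟨_, hp u⟩)
    have hdom' := (Part.dom_iff_mem.2 ⟨_, hp u'⟩)
    have hpp : p u = p u' := by
      rcases List.prefix_or_prefix_of_prefix (List.prefix_append (p u) _)
        (h1 ▸ List.prefix_append (p u') _) with h | h
      · exact hU.prefixFree _ _ _ hdom hdom' h
      · exact (hU.prefixFree _ _ _ hdom' hdom h).symm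
    have hss : s u = s u' := Part.mem_unique (hp u) (hpp ▸ hp u')
    exact Subtype.ext ((hs u).unique hn (hss ▸ hs u'))
  refine ⟨Finite.of_injective f hf, ?_⟩
  have := Nat.card_le_card_of_injective f hf
  rwa [Nat.card_eq_fintype_card (α := List.Vector Bool k), card_vector, Fintype.card_bool] at this

/-! ### Recovery by minimum complexity pursuit -/

theorem IsMCPSolution.exists_vecKolmogorov_le {U : List Bool → List Bool →. List Bool}
    (hU : IsOptimalPrefixMachine U) {d n m : ℕ} {A : Matrix (Fin d) (Fin n) ℝ} {x₀ x : Fin n → ℝ}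
    (hx₀ : x₀ ∈ Set.Icc (0 : Fin n → ℝ) 1) (hx : IsMCPSolution U m A (A *ᵥ x₀) x) :
    ∃ u : Fin n → ℝ, ‖x - u‖ ≤ (1 / 2) ^ m ∧
      vecKolmogorov U m u ≤ ((resKolmogorov U m x₀).toNat : ℕ∞) := by
  have h := hx.2 x₀ hx₀ rfl
  rw [← ENat.natCast_toNat (resKolmogorov_ne_top hU m hx₀)] at h
  obtain ⟨u, hu, hk⟩ := exists_le_of_iInf₂_le_natCast h
  exact ⟨u, hu.2, hk⟩

/-- The deterministic part of the recovery guarantee: `x₀ - u` and `x - u` have the same image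
under `A`, the second image is small and `A` does not shrink `x₀ - u` much. -/
theorem norm_sub_le_of_mulVec_eq {d n : ℕ} (hd : 0 < d) {A : Matrix (Fin d) (Fin n) ℝ}
    {x₀ x u : Fin n → ℝ} {δ t : ℝ} (hδ : 0 ≤ δ) (ht : t < 1) (hA : A *ᵥ x = A *ᵥ x₀)
    (hxu : ‖x - u‖ ≤ δ)
    (hcube : ∑ i, (∑ j, A i j * (x - u) j) ^ 2 ≤ δ ^ 2 * n * (√(n : ℝ) + 2 * √(d : ℝ)) ^ 2)
    (hlow : d * (1 - t) * ∑ j, (x₀ - u) j ^ 2 ≤ ∑ i, (∑ j, (x₀ - u) j * A i j) ^ 2) :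
    ‖WithLp.toLp 2 (x₀ - x)‖ ≤ (1 / √(1 - t) * (√((n : ℝ) / d) + 2) + 1) * (√(n : ℝ) * δ) := by
  have ht' : 0 < 1 - t := sub_pos.2 ht
  have hd' : (0 : ℝ) < d := Nat.cast_pos.2 hd
  have himage : ∑ i, (∑ j, (x₀ - u) j * A i j) ^ 2 = ∑ i, (∑ j, A i j * (x - u) j) ^ 2 := by
    refine Finset.sum_congr rfl fun i _ => ?_
    have h : A *ᵥ (x - u) = A *ᵥ (x₀ - u) := by rw [Matrix.mulVec_sub, Matrix.mulVec_sub, hA]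
    have hi := congrFun h i
    simp only [Matrix.mulVec, dotProduct] at hi
    rw [hi]
    simp_rw [mul_comm]
  have h1 : ‖WithLp.toLp 2 (x₀ - u)‖ ≤ 1 / √(1 - t) * (√((n : ℝ) / d) + 2) * (√(n : ℝ) * δ) := by
    rw [EuclideanSpace.norm_eq]
    refine Real.sqrt_le_iff.2 ⟨by positivity, ?_⟩
    simp only [Real.norm_eq_abs, sq_abs]
    have h2 := hlow.trans (himage.trans_le hcube)
    rw [mul_comm, ← le_div_iff₀ (by positivity)] at h2
    refine h2.trans (le_of_eq ?_)
    rw [Real.sqrt_div (Nat.cast_nonneg n)]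
    have hs := Real.sq_sqrt ht'.le
    have hds := Real.sq_sqrt hd'.le
    have hns := Real.sq_sqrt (Nat.cast_nonneg n : (0 : ℝ) ≤ n)
    have hs0 : √(1 - t) ≠ 0 := (Real.sqrt_pos.2 ht').ne'
    have hd0 : √(d : ℝ) ≠ 0 := (Real.sqrt_pos.2 hd').ne'
    have hfac : √(n : ℝ) / √(d : ℝ) + 2 = (√(n : ℝ) + 2 * √(d : ℝ)) / √(d : ℝ) := by
      field_simp
    rw [hfac]
    simp only [mul_pow, div_pow, hs, hds, hns, one_pow]
    field_simp
  have h2 : ‖WithLp.toLp 2 (u - x)‖ ≤ √(n : ℝ) * δ := by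
    rw [EuclideanSpace.norm_eq]
    refine Real.sqrt_le_iff.2 ⟨by positivity, ?_⟩
    rw [mul_pow, Real.sq_sqrt (Nat.cast_nonneg n)]
    calc ∑ j, ‖(u - x) j‖ ^ 2 ≤ ∑ _j : Fin n, δ ^ 2 := by
          refine Finset.sum_le_sum fun j _ => pow_le_pow_left₀ (norm_nonneg _) ?_ 2
          exact (norm_le_pi_norm (u - x) j).trans ((norm_sub_rev u x).trans_le hxu)
      _ = n * δ ^ 2 := by simp
  have h3 : WithLp.toLp 2 (x₀ - x) = WithLp.toLp 2 (x₀ - u) + WithLp.toLp 2 (u - x) := by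
    rw [← WithLp.toLp_add, sub_add_sub_cancel]
  rw [h3, add_mul, one_mul]
  exact (norm_add_le _ _).trans (add_le_add h1 h2)

theorem theorem1
    (U : List Bool → List Bool →. List Bool) (hU : IsOptimalPrefixMachine U)
    {d n m : ℕ} (hd : 0 < d) (hn : 0 < n) (hm : 0 < m)
    (x₀ : Fin n → ℝ) (hx₀ : x₀ ∈ Set.Icc (0 : Fin n → ℝ) 1)
    {Ω : Type*} [MeasurableSpace Ω] (P : Measure Ω) [IsProbabilityMeasure P]
    (A : Ω → Matrix (Fin d) (Fin n) ℝ)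
    (hlaw : ∀ i j, HasLaw (fun ω => A ω i j) (gaussianReal 0 1) P)
    (hindep : iIndepFun (fun (ij : Fin d × Fin n) ω => A ω ij.1 ij.2) P)
    (xhat : Ω → Fin n → ℝ)
    (hxhat : ∀ᵐ ω ∂P, IsMCPSolution U m (A ω) (A ω *ᵥ x₀) (xhat ω))
    (t : ℝ) (ht : t ∈ Set.Ioo (0 : ℝ) 1) :
    P {ω | (1 / √(1 - t) * (√((n : ℝ) / d) + 2) + 1) * (√(n : ℝ) / 2 ^ m)
            < ‖WithLp.toLp 2 (x₀ - xhat ω)‖}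
      ≤ ENNReal.ofReal
          ((2 : ℝ) ^ (infoDim U m x₀ * m) * Real.exp ((d : ℝ) / 2 * (t + Real.log (1 - t)))
            + Real.exp (-((d : ℝ) / 2))) := by
  have : Nonempty (Fin n) := ⟨⟨0, hn⟩⟩
  set k := (resKolmogorov U m x₀).toNat
  obtain ⟨hfin, hcard⟩ := finite_and_ncard_vecKolmogorov_le hU.toIsPrefixMachine hn m k
  have hrows : HasLaw (fun ω i j => A ω i j) (stdGaussianMatrix (Fin d) (Fin n)) P :=
    hasLaw_stdGaussianMatrix (X := fun i j ω => A ω i j) hlaw hindep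
  have hcols : HasLaw (fun ω j i => A ω i j) (stdGaussianMatrix (Fin n) (Fin d)) P :=
    hasLaw_stdGaussianMatrix (X := fun j i ω => A ω i j) (fun j i => hlaw i j)
      (hindep.precomp Prod.swap_injective)
  -- The event that `A` expands some vector of the cube of half-width `2⁻ᵐ` too much.
  let E₂ : Set Ω := {ω | ∃ v : Fin n → ℝ, (∀ j, |v j| ≤ (1 / 2) ^ m) ∧
    ((1 / 2) ^ m) ^ 2 * n * (√(n : ℝ) + 2 * √(d : ℝ)) ^ 2 < ∑ i, (∑ j, A ω i j * v j) ^ 2}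
  -- The event that `A` shrinks `x₀ - u` too much.
  let E₁ : (Fin n → ℝ) → Set Ω := fun u => {ω | ∑ i, (∑ j, (x₀ - u) j * A ω i j) ^ 2
    < d * (1 - t) * ∑ j, (x₀ - u) j ^ 2}
  have hE₂ : P E₂ ≤ ENNReal.ofReal (Real.exp (-((d : ℝ) / 2))) := by
    have h := stdGaussianMatrix_cube_le (κ := Fin d) (ι := Fin n)
      (δ := (1 / 2) ^ m) (by positivity)
    simp only [Fintype.card_fin] at h
    rw [← hcols.map_eq] at h
    exact (Measure.le_map_apply hcols.aemeasurable _).trans h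
  have hE₁ : ∀ u, P (E₁ u)
      ≤ ENNReal.ofReal (Real.exp ((d : ℝ) / 2 * (t + Real.log (1 - t)))) := fun u => by
    have h := stdGaussianMatrix_sum_sq_lt_le (κ := Fin d) (x₀ - u) ht
    simp only [Fintype.card_fin] at h
    rw [← hrows.map_eq] at h
    exact (Measure.le_map_apply hrows.aemeasurable _).trans h
  have hsub : ∀ᵐ ω ∂P, ω ∈ {ω | (1 / √(1 - t) * (√((n : ℝ) / d) + 2) + 1) * (√(n : ℝ) / 2 ^ m)
      < ‖WithLp.toLp 2 (x₀ - xhat ω)‖} → ω ∈ (⋃ u ∈ hfin.toFinset, E₁ u) ∪ E₂ := by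
    filter_upwards [hxhat] with ω hω hbad
    obtain ⟨u, hu, huk⟩ := hω.exists_vecKolmogorov_le hU hx₀
    by_contra hgood
    rw [Set.mem_union, not_or] at hgood
    obtain ⟨hg₁, hg₂⟩ := hgood
    refine (not_le.2 hbad) ?_
    have hδ : √(n : ℝ) / 2 ^ m = √(n : ℝ) * (1 / 2) ^ m := by
      rw [one_div, inv_pow, div_eq_mul_inv]
    rw [hδ]
    refine norm_sub_le_of_mulVec_eq hd (by positivity) ht.2 hω.1.2 hu ?_ ?_
    · by_contra h
      exact hg₂ ⟨xhat ω - u, fun j => (norm_le_pi_norm (xhat ω - u) j).trans hu, not_le.1 h⟩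
    · by_contra h
      exact hg₁ (Set.mem_biUnion (hfin.mem_toFinset.2 huk) (not_le.1 h))
  have hpow : (2 : ℝ) ^ (infoDim U m x₀ * m) = 2 ^ k := by
    rw [infoDim, div_mul_cancel₀ _ (Nat.cast_ne_zero.2 hm.ne'), Real.rpow_natCast]
  calc P _ ≤ P ((⋃ u ∈ hfin.toFinset, E₁ u) ∪ E₂) := measure_mono_ae hsub
    _ ≤ P (⋃ u ∈ hfin.toFinset, E₁ u) + P E₂ := measure_union_le _ _
    _ ≤ 2 ^ k * ENNReal.ofReal (Real.exp ((d : ℝ) / 2 * (t + Real.log (1 - t))))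
        + ENNReal.ofReal (Real.exp (-((d : ℝ) / 2))) := by
        refine add_le_add ((measure_biUnion_finset_le _ _).trans ?_) hE₂
        refine (Finset.sum_le_sum fun u _ => hE₁ u).trans ?_
        rw [Finset.sum_const, nsmul_eq_mul, ← Set.ncard_eq_toFinset_card _ hfin]
        gcongr
        exact_mod_cast hcard
    _ = _ := by
        rw [hpow, ENNReal.ofReal_add (by positivity) (Real.exp_pos _).le,
          ENNReal.ofReal_mul (by positivity), ENNReal.ofReal_pow (by norm_num)]
        simp
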